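/- Conventions. An $F$-inverse monoid is an inverse monoid $S$ in which every class of the minimum group congruence $\sigma$ has a greatest element in the natural partial order; it is viewed in the signature $(\cdot,1,{}^{-1},{}^{\mathfrak m})$, where $a^{\mathfrak m}$ is the greatest element of the $\sigma$-class of $a$. Let $X$ be a set and let $\mathbb{I}\mathfrak{m}_X$ be the set of formal terms $w=u_0v_1^{\mathfrak m}u_1\cdots v_n^{\mathfrak m}u_n$ with $n\ge 0$ and words $u_i,v_i\in(X\cup X^{-1})^*$. Let $R$ be a symmetric relation on $\mathbb{I}\mathfrak{m}_X$, let $S=\operatorname{FInv}\langle X\mid R\rangle$ be the $F$-inverse monoid it presents (the quotient of the free $F$-inverse monoid on $X$ by the congruence generated by $R$), let $G=S/\sigma$ be its greatest group image, and let $\Gamma_X$ be the Cayley graph of $G$ with respect to $X$. Write $w_S$ and $w_G$ for the values of a term $w$ in $S$ and in $G$ (in $G$, ${}^{\mathfrak m}$ is the identity map). A subgraph of $\Gamma_X$ is a set of vertices and edges closed under initial vertices, terminal vertices and inverse edges; it need not be connected. For $g\in G$, the journey labeled by $w=u_0v_1^{\mathfrak m}u_1\cdots v_n^{\mathfrak m}u_n$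 starting at $g$ is the sequence of paths in $\Gamma_X$ labeled by $u_0,u_1,\dots,u_n$ and starting at the vertices $g,\ g(u_0v_1)_G,\ \dots,\ g(u_0v_1\cdots u_{n-1}v_n)_G$ respectively; it leads from $g$ to $gw_G$. The subgraph it spans is the union of the subgraphs spanned by these paths, and the journey is in a subgraph $\Delta$ if that span is contained in $\Delta$. Let $\overline w$ be the journey labeled by $w$ starting at $1$, and $\langle\overline w\rangle$ the subgraph it spans. For a symmetric relation $Q$ on $\mathbb{I}\mathfrak{m}_X$ with $u_G=v_G$ whenever $(u,v)\in Q$, a subgraph $\Delta$ is $c_Q$-closed if for all $(u,v)\in Q$ and all vertices $g,h$ of $\Delta$, $u$ labels a journey in $\Delta$ from $g$ to $h$ if and only if $v$ does; $\Delta^{c_Q}$ denotes the intersection of all $c_Q$-closed subgraphs containing $\Delta$. Write $c_S$ for $c_Q$ with $Q=\{(u,v): u_S=v_S\}$. The $F$-Schützenberger graph of $w$ is $F\Gamma(w)=\langle\overline w\rangle^{c_S}$. The full $P$-expansion of $\Delta$ with respect to $R$ is the union of $\Delta$ and all subgraphs spanned by a journey labeled by $v$ starting at $g$ that is not in $\Delta$,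 where $g\in G$, $(u,v)\in R$ and the journey labeled by $u$ starting at $g$ is in $\Delta$. Theorem. For every $w\in\mathbb{I}\mathfrak{m}_X$, $F\Gamma(w)=\langle\overline w\rangle^{c_R}$, and this is the smallest $c_R$-closed subgraph of $\Gamma_X$ containing $\overline w$. Furthermore, $F\Gamma(w)=\bigcup_{i=1}^{\infty}\Delta_i$, where $\Delta_0=\langle\overline w\rangle$ and, for $i\ge 0$, $\Delta_{i+1}$ is the full $P$-expansion of $\Delta_i$ with respect to $R$. -/

import Mathlib

namespace FInvPres

universe u v

/-! ### Inverse monoids and the minimum group congruence -/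

/-- An inverse monoid: every element `a` has a unique (von Neumann) inverse `a⁻¹`. -/
class InverseMonoid (S : Type u) extends Monoid S, Inv S where
  mul_inv_mul : ∀ a : S, a * a⁻¹ * a = a
  inv_mul_inv : ∀ a : S, a⁻¹ * a * a⁻¹ = a⁻¹
  inv_unique : ∀ a b : S, a * b * a = a → b * a * b = b → b = a⁻¹

namespace InverseMonoid

variable {S : Type u} [InverseMonoid S]

/-- The natural partial order: `a ≤ b` iff `a = e b` for some idempotent `e`. -/
def NatLE (a b : S) : Prop := ∃ e : S, e * e = e ∧ a = e * b

/-- The relation `σ`: `a σ b` iff `e a = e b` for some idempotent `e`. -/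
def Sigma (a b : S) : Prop := ∃ e : S, e * e = e ∧ e * a = e * b

theorem inv_of_idem {e : S} (he : e * e = e) : e⁻¹ = e :=
  (inv_unique e e (by rw [he, he]) (by rw [he, he])).symm

theorem inv_inv' (a : S) : a⁻¹⁻¹ = a :=
  (inv_unique a⁻¹ a (inv_mul_inv a) (mul_inv_mul a)).symm

theorem idem_mul_idem {e f : S} (he : e * e = e) (hf : f * f = f) :
    e * f * (e * f) = e * f := by
  have h1 := mul_inv_mul (e * f)
  have h2 := inv_mul_inv (e * f)
  generalize hx : (e * f)⁻¹ = x at h1 h2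
  have key : f * x * e = x := by
    rw [← hx]
    refine inv_unique (e * f) _ ?_ ?_ <;> rw [hx]
    · calc e * f * (f * x * e) * (e * f) = e * (f * f) * x * (e * e) * f := by
            simp only [mul_assoc]
        _ = e * f * x * (e * f) := by rw [he, hf]; simp only [mul_assoc]
        _ = e * f := h1
    · calc f * x * e * (e * f) * (f * x * e) = f * (x * (e * e) * (f * f) * x) * e := by
            simp only [mul_assoc]
        _ = f * (x * (e * f) * x) * e := by rw [he, hf]; simp only [mul_assoc]
        _ = f * x * e := by rw [h2]
  have hxx : x * x = x := by
    calc x * x = f * x * e * (f * x * e) := by rw [key]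
      _ = f * (x * (e * f) * x) * e := by simp only [mul_assoc]
      _ = x := by rw [h2, key]
  have : e * f = x := by
    rw [← inv_inv' (e * f), hx, inv_of_idem hxx]
  rw [this, hxx]

theorem idem_comm {e f : S} (he : e * e = e) (hf : f * f = f) : e * f = f * e := by
  have h1 := idem_mul_idem he hf
  have h2 := idem_mul_idem hf he
  have h3 : f * e = (e * f)⁻¹ := by
    refine inv_unique (e * f) (f * e) ?_ ?_
    · calc e * f * (f * e) * (e * f) = e * (f * f) * (e * e) * f := by simp only [mul_assoc]
        _ = e * f * (e * f) := by rw [he, hf]; simp only [mul_assoc]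
        _ = e * f := h1
    · calc f * e * (e * f) * (f * e) = f * (e * e) * (f * f) * e := by simp only [mul_assoc]
        _ = f * e * (f * e) := by rw [he, hf]; simp only [mul_assoc]
        _ = f * e := h2
  rw [h3, inv_of_idem h1]

theorem mul_inv_idem (a : S) : a * a⁻¹ * (a * a⁻¹) = a * a⁻¹ := by
  rw [← mul_assoc, mul_inv_mul]

theorem inv_mul_idem (a : S) : a⁻¹ * a * (a⁻¹ * a) = a⁻¹ * a := by
  rw [← mul_assoc, inv_mul_inv]

theorem mul_inv_rev' (a b : S) : (a * b)⁻¹ = b⁻¹ * a⁻¹ := by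
  have hc := idem_comm (mul_inv_idem b) (inv_mul_idem a)
  refine (inv_unique (a * b) (b⁻¹ * a⁻¹) ?_ ?_).symm
  · calc a * b * (b⁻¹ * a⁻¹) * (a * b) = a * (b * b⁻¹ * (a⁻¹ * a)) * b := by
          simp only [mul_assoc]
      _ = a * a⁻¹ * a * (b * b⁻¹ * b) := by rw [hc]; simp only [mul_assoc]
      _ = a * b := by rw [mul_inv_mul, mul_inv_mul]
  · calc b⁻¹ * a⁻¹ * (a * b) * (b⁻¹ * a⁻¹) = b⁻¹ * (a⁻¹ * a * (b * b⁻¹)) * a⁻¹ := by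
          simp only [mul_assoc]
      _ = b⁻¹ * b * b⁻¹ * (a⁻¹ * a * a⁻¹) := by rw [← hc]; simp only [mul_assoc]
      _ = b⁻¹ * a⁻¹ := by rw [inv_mul_inv, inv_mul_inv]

theorem conj_idem (a : S) {f : S} (hf : f * f = f) :
    a * f * a⁻¹ * (a * f * a⁻¹) = a * f * a⁻¹ := by
  have hc := idem_comm hf (inv_mul_idem a)
  calc a * f * a⁻¹ * (a * f * a⁻¹) = a * (f * (a⁻¹ * a)) * f * a⁻¹ := by simp only [mul_assoc]
    _ = a * a⁻¹ * a * (f * f) * a⁻¹ := by rw [hc]; simp only [mul_assoc]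
    _ = a * f * a⁻¹ := by rw [mul_inv_mul, hf]

theorem conj_mul (a : S) {f : S} (hf : f * f = f) : a * f * a⁻¹ * a = a * f := by
  have hc := idem_comm hf (inv_mul_idem a)
  calc a * f * a⁻¹ * a = a * (f * (a⁻¹ * a)) := by simp only [mul_assoc]
    _ = a * a⁻¹ * a * f := by rw [hc]; simp only [mul_assoc]
    _ = a * f := by rw [mul_inv_mul]

theorem natLE_antisymm {a b : S} (h1 : NatLE a b) (h2 : NatLE b a) : a = b := by
  obtain ⟨e, he, hab⟩ := h1
  obtain ⟨f, hf, hba⟩ := h2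
  have hea : e * a = a := by rw [hab, ← mul_assoc, he]
  calc a = e * (f * a) := by rw [← hba, hab]
    _ = f * (e * a) := by rw [← mul_assoc, idem_comm he hf, mul_assoc]
    _ = b := by rw [hea, hba]

theorem sigma_refl (a : S) : Sigma a a := ⟨1, one_mul 1, rfl⟩

theorem sigma_symm {a b : S} : Sigma a b → Sigma b a
  | ⟨e, he, h⟩ => ⟨e, he, h.symm⟩

theorem sigma_trans {a b c : S} (h1 : Sigma a b) (h2 : Sigma b c) : Sigma a c := by
  obtain ⟨e, he, hab⟩ := h1
  obtain ⟨f, hf, hbc⟩ := h2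
  refine ⟨e * f, idem_mul_idem he hf, ?_⟩
  rw [idem_comm he hf, mul_assoc, hab, ← mul_assoc, ← idem_comm he hf, mul_assoc, hbc, mul_assoc]

theorem sigma_mul_left (a : S) {c d : S} (h : Sigma c d) : Sigma (a * c) (a * d) := by
  obtain ⟨f, hf, hcd⟩ := h
  refine ⟨a * f * a⁻¹, conj_idem a hf, ?_⟩
  rw [← mul_assoc, ← mul_assoc, conj_mul a hf, mul_assoc, mul_assoc, hcd]

theorem sigma_mul_right {a b : S} (c : S) (h : Sigma a b) : Sigma (a * c) (b * c) := by
  obtain ⟨e, he, hab⟩ := h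
  exact ⟨e, he, by rw [← mul_assoc, ← mul_assoc, hab]⟩

/-- `σ` as a congruence. -/
def sigmaCon (S : Type u) [InverseMonoid S] : Con S where
  r := Sigma
  iseqv := ⟨sigma_refl, sigma_symm, sigma_trans⟩
  mul' := fun {_ b c _} h1 h2 => sigma_trans (sigma_mul_right c h1) (sigma_mul_left b h2)

theorem sigma_inv_mul (a : S) : Sigma (a⁻¹ * a) 1 :=
  ⟨a⁻¹ * a, inv_mul_idem a, by rw [inv_mul_idem, mul_one]⟩

theorem sigma_mul_inv (a : S) : Sigma (a * a⁻¹) 1 :=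
  ⟨a * a⁻¹, mul_inv_idem a, by rw [mul_inv_idem, mul_one]⟩

theorem sigma_inv {a b : S} (h : Sigma a b) : Sigma a⁻¹ b⁻¹ := by
  have h1 : Sigma (a⁻¹ * (b * b⁻¹)) a⁻¹ := by
    simpa using sigma_mul_left a⁻¹ (sigma_mul_inv b)
  have h2 : Sigma (a⁻¹ * (a * b⁻¹)) (a⁻¹ * (b * b⁻¹)) :=
    sigma_mul_left _ (sigma_mul_right _ h)
  have h3 : Sigma (a⁻¹ * (a * b⁻¹)) b⁻¹ := by
    simpa [mul_assoc] using sigma_mul_right b⁻¹ (sigma_inv_mul a)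
  exact sigma_trans (sigma_symm (sigma_trans h2 h1)) h3

end InverseMonoid

open InverseMonoid

/-- The greatest group image `S / σ` of an inverse monoid. -/
def GroupImage (S : Type u) [InverseMonoid S] : Type u := (sigmaCon S).Quotient

/-- The natural projection `σ♯ : S → S / σ`. -/
def toGroupImage {S : Type u} [InverseMonoid S] (s : S) : GroupImage S :=
  Quotient.mk (sigmaCon S).toSetoid s

instance instGroupGroupImage (S : Type u) [InverseMonoid S] : Group (GroupImage S) where
  __ := (inferInstance : Monoid (sigmaCon S).Quotient)
  inv := Quotient.map (fun a : S => a⁻¹) (fun _ _ h => sigma_inv h)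
  inv_mul_cancel a := by
    induction a using Quotient.inductionOn with
    | _ a => exact Quotient.sound (sigma_inv_mul a)

theorem toGroupImage_eq_iff {S : Type u} [InverseMonoid S] {a b : S} :
    toGroupImage a = toGroupImage b ↔ Sigma a b :=
  ⟨fun h => Quotient.exact h, fun h => Quotient.sound h⟩

theorem toGroupImage_mul {S : Type u} [InverseMonoid S] (a b : S) :
    toGroupImage (a * b) = toGroupImage a * toGroupImage b := rfl

theorem toGroupImage_one {S : Type u} [InverseMonoid S] :
    toGroupImage (1 : S) = 1 := rfl

theorem toGroupImage_inv {S : Type u} [InverseMonoid S] (a : S) :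
    toGroupImage a⁻¹ = (toGroupImage a)⁻¹ := rfl

/-- `S / σ` is the greatest group image: every morphism to a group factors through it. -/
theorem map_eq_of_toGroupImage_eq {S : Type u} [InverseMonoid S] {H : Type v} [Group H]
    (f : S →* H) {a b : S} (h : toGroupImage a = toGroupImage b) : f a = f b := by
  obtain ⟨e, he, hab⟩ := toGroupImage_eq_iff.1 h
  have h1 : f e = 1 := by
    have := congrArg f he
    rwa [map_mul, mul_eq_left] at this
  simpa [h1] using congrArg f hab

/-! ### F-inverse monoids in the extended signature -/

/-- An `F`-inverse monoid: `m a` is the greatest element of the `σ`-class of `a`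
with respect to the natural partial order. -/
class FInverseMonoid (S : Type u) extends InverseMonoid S where
  m : S → S
  sigma_m : ∀ a : S, InverseMonoid.Sigma a (m a)
  le_m : ∀ a b : S, InverseMonoid.Sigma a b → InverseMonoid.NatLE b (m a)

namespace FInverseMonoid

variable {S : Type u} [FInverseMonoid S]

theorem m_eq_of_sigma {a b : S} (h : Sigma a b) : m a = m b :=
  natLE_antisymm (le_m b (m a) (sigma_trans (sigma_symm h) (sigma_m a)))
    (le_m a (m b) (sigma_trans h (sigma_m b)))

theorem mul_inv_mul_m (a : S) : a * a⁻¹ * m a = a := by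
  obtain ⟨e, he, h⟩ := le_m a a (sigma_refl a)
  have hea : e * a = a := by rw [h, ← mul_assoc, he]
  calc a * a⁻¹ * m a = e * (a * a⁻¹) * m a := by rw [← mul_assoc, hea]
    _ = a * a⁻¹ * (e * m a) := by rw [idem_comm he (mul_inv_idem a), mul_assoc]
    _ = a := by rw [← h, mul_inv_mul]

theorem m_absorb (a b : S) : m (a * a⁻¹ * b) = m b :=
  m_eq_of_sigma ⟨a * a⁻¹, mul_inv_idem a, by rw [← mul_assoc, mul_inv_idem]⟩

end FInverseMonoid

/-! ### Words and terms -/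

/-- The alphabet `X ∪ X⁻¹`: `(x, true)` stands for `x` and `(x, false)` for `x⁻¹`. -/
abbrev Letter (X : Type u) : Type u := X × Bool

/-- The formal inverse of a letter. -/
def Letter.inv {X : Type u} (a : Letter X) : Letter X := (a.1, !a.2)

/-- Words over `X ∪ X⁻¹`. -/
abbrev Word (X : Type u) : Type u := List (Letter X)

/-- The set of formal expressions `u₀ v₁ᵐ u₁ ⋯ vₙᵐ uₙ` with words `uᵢ, vᵢ`; here `head = u₀`
and `tail = [(v₁, u₁), …, (vₙ, uₙ)]`. -/
structure ImTerm (X : Type u) : Type u where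
  head : Word X
  tail : List (Word X × Word X)

section Values

variable {X : Type u} {M : Type v} [Monoid M] [Inv M]

/-- The value of a letter under an assignment `ι` of the generators. -/
def letterVal (ι : X → M) (a : Letter X) : M := if a.2 then ι a.1 else (ι a.1)⁻¹

/-- The value of a word. -/
def wordVal (ι : X → M) (w : Word X) : M := (w.map (letterVal ι)).prod

/-- The value of the term `u₀ v₁ᵐ u₁ ⋯ vₙᵐ uₙ` under an assignment `ι` of the generators, where `m`
is the interpretation of the unary operation. -/
def ImTerm.val (m : M → M) (ι : X → M) (w : ImTerm X) : M :=
  wordVal ι w.head * (w.tail.map fun p => m (wordVal ι p.1) * wordVal ι p.2).prod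

end Values

/-- The value `w_S` of a term in an `F`-inverse monoid `S` with generators `ι`. -/
def ImTerm.valS {X : Type u} {S : Type v} [FInverseMonoid S] (ι : X → S) (w : ImTerm X) : S :=
  w.val FInverseMonoid.m ι

/-- The value `w_G` of a term in a group `G` with generators `ι`; a group is an
`F`-inverse monoid where `m` is the identity map. -/
def ImTerm.valG {X : Type u} {G : Type v} [Group G] (ι : X → G) (w : ImTerm X) : G :=
  w.val id ι

/-- The generators of the greatest group image of `S` that are induced by those of `S`. -/
def groupGen {X : Type u} {S : Type v} [InverseMonoid S] (ι : X → S) : X → GroupImage S :=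
  fun x => toGroupImage (ι x)

section

variable {X : Type u} {S : Type v}

theorem wordVal_groupGen [InverseMonoid S] (ι : X → S) (w : Word X) :
    wordVal (groupGen ι) w = toGroupImage (wordVal ι w) := by
  induction w with
  | nil => rfl
  | cons a w ih =>
    have h1 : wordVal ι (a :: w) = letterVal ι a * wordVal ι w := by simp [wordVal]
    have h2 : wordVal (groupGen ι) (a :: w) =
        letterVal (groupGen ι) a * wordVal (groupGen ι) w := by simp [wordVal]
    rw [h1, h2, toGroupImage_mul, ih]
    congr 1
    unfold letterVal
    split <;> rfl

theorem toGroupImage_m [FInverseMonoid S] (a : S) :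
    toGroupImage (FInverseMonoid.m a) = toGroupImage a :=
  (toGroupImage_eq_iff.2 (FInverseMonoid.sigma_m a)).symm

theorem valG_groupGen [FInverseMonoid S] (ι : X → S) (w : ImTerm X) :
    w.valG (groupGen ι) = toGroupImage (w.valS ι) := by
  obtain ⟨u, t⟩ := w
  simp only [ImTerm.valG, ImTerm.valS, ImTerm.val, toGroupImage_mul, wordVal_groupGen]
  congr 1
  induction t with
  | nil => rfl
  | cons p t ih =>
    rw [List.map_cons, List.prod_cons, ih]
    simp only [List.map_cons, List.prod_cons, toGroupImage_mul, toGroupImage_m, id_eq]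

end

/-! ### Presentations -/

/-- Terms in the full signature `(·, 1, ⁻¹, ᵐ)`. -/
inductive FTerm (X : Type u) : Type u where
  | var : X → FTerm X
  | one : FTerm X
  | mul : FTerm X → FTerm X → FTerm X
  | inv : FTerm X → FTerm X
  | m : FTerm X → FTerm X

namespace FTerm

variable {X : Type u}

def ofLetter (a : Letter X) : FTerm X := if a.2 then var a.1 else inv (var a.1)

def ofWord : Word X → FTerm X
  | [] => one
  | a :: w => mul (ofLetter a) (ofWord w)

def ofTail : List (Word X × Word X) → FTerm X
  | [] => one
  | p :: t => mul (mul (m (ofWord p.1)) (ofWord p.2)) (ofTail t)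

/-- A formal expression `u₀ v₁ᵐ u₁ ⋯ vₙᵐ uₙ` as a term in the full signature. -/
def ofIm (w : ImTerm X) : FTerm X := mul (ofWord w.head) (ofTail w.tail)

/-- Evaluation in an `F`-inverse monoid. -/
def eval {S : Type v} [FInverseMonoid S] (ι : X → S) : FTerm X → S
  | var x => ι x
  | one => 1
  | mul s t => eval ι s * eval ι t
  | inv s => (eval ι s)⁻¹
  | m s => FInverseMonoid.m (eval ι s)

end FTerm

/-- The congruence on terms generated by the identities of the variety of `F`-inverse monoids
together with the pairs in `R`. -/
inductive FInvRel {X : Type u} (R : ImTerm X → ImTerm X → Prop) : FTerm X → FTerm X → Prop where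
  | refl (s) : FInvRel R s s
  | symm {s t} : FInvRel R s t → FInvRel R t s
  | trans {s t r} : FInvRel R s t → FInvRel R t r → FInvRel R s r
  | mul_congr {s s' t t'} : FInvRel R s s' → FInvRel R t t' → FInvRel R (.mul s t) (.mul s' t')
  | inv_congr {s s'} : FInvRel R s s' → FInvRel R (.inv s) (.inv s')
  | m_congr {s s'} : FInvRel R s s' → FInvRel R (.m s) (.m s')
  | mul_assoc (s t r) : FInvRel R (.mul (.mul s t) r) (.mul s (.mul t r))
  | one_mul (s) : FInvRel R (.mul .one s) s
  | mul_one (s) : FInvRel R (.mul s .one) s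
  | inv_inv (s) : FInvRel R (.inv (.inv s)) s
  | mul_inv_rev (s t) : FInvRel R (.inv (.mul s t)) (.mul (.inv t) (.inv s))
  | mul_inv_mul (s) : FInvRel R (.mul (.mul s (.inv s)) s) s
  | idem_comm (s t) : FInvRel R (.mul (.mul s (.inv s)) (.mul t (.inv t)))
      (.mul (.mul t (.inv t)) (.mul s (.inv s)))
  | mul_inv_mul_m (s) : FInvRel R (.mul (.mul s (.inv s)) (.m s)) s
  | m_absorb (s t) : FInvRel R (.m (.mul (.mul s (.inv s)) t)) (.m t)
  | rel {u v} : R u v → FInvRel R (.ofIm u) (.ofIm v)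

def FInvRel.setoid {X : Type u} (R : ImTerm X → ImTerm X → Prop) : Setoid (FTerm X) where
  r := FInvRel R
  iseqv := ⟨.refl, .symm, .trans⟩

/-- The `F`-inverse monoid `FInv⟨X | R⟩` presented by the generators `X` and the relations `R`. -/
def FInv {X : Type u} (R : ImTerm X → ImTerm X → Prop) : Type u := Quotient (FInvRel.setoid R)

namespace FInv

variable {X : Type u} {R : ImTerm X → ImTerm X → Prop}

/-- The class of a term. -/
def mk (R : ImTerm X → ImTerm X → Prop) (s : FTerm X) : FInv R := Quotient.mk _ s

/-- The canonical generators of `FInv⟨X | R⟩`. -/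
def gen (R : ImTerm X → ImTerm X → Prop) (x : X) : FInv R := mk R (.var x)

instance instMonoid : Monoid (FInv R) where
  mul := Quotient.map₂ FTerm.mul fun _ _ h1 _ _ h2 => FInvRel.mul_congr h1 h2
  one := mk R .one
  mul_assoc a b c := by
    induction a using Quotient.inductionOn
    induction b using Quotient.inductionOn
    induction c using Quotient.inductionOn
    exact Quotient.sound (FInvRel.mul_assoc _ _ _)
  one_mul a := by
    induction a using Quotient.inductionOn
    exact Quotient.sound (FInvRel.one_mul _)
  mul_one a := by
    induction a using Quotient.inductionOn
    exact Quotient.sound (FInvRel.mul_one _)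

instance instInv : Inv (FInv R) where
  inv := Quotient.map FTerm.inv fun _ _ h => FInvRel.inv_congr h

/-- The operation `ᵐ` on `FInv⟨X | R⟩`. -/
def opM : FInv R → FInv R := Quotient.map FTerm.m fun _ _ h => FInvRel.m_congr h

theorem inv_inv_eq (a : FInv R) : a⁻¹⁻¹ = a := by
  induction a using Quotient.inductionOn
  exact Quotient.sound (FInvRel.inv_inv _)

theorem mul_inv_rev_eq (a b : FInv R) : (a * b)⁻¹ = b⁻¹ * a⁻¹ := by
  induction a using Quotient.inductionOn
  induction b using Quotient.inductionOn
  exact Quotient.sound (FInvRel.mul_inv_rev _ _)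

theorem mul_inv_mul_eq (a : FInv R) : a * a⁻¹ * a = a := by
  induction a using Quotient.inductionOn
  exact Quotient.sound (FInvRel.mul_inv_mul _)

theorem idem_comm_eq (a b : FInv R) : a * a⁻¹ * (b * b⁻¹) = b * b⁻¹ * (a * a⁻¹) := by
  induction a using Quotient.inductionOn
  induction b using Quotient.inductionOn
  exact Quotient.sound (FInvRel.idem_comm _ _)

theorem mul_inv_mul_m_eq (a : FInv R) : a * a⁻¹ * opM a = a := by
  induction a using Quotient.inductionOn
  exact Quotient.sound (FInvRel.mul_inv_mul_m _)

theorem m_absorb_eq (a b : FInv R) : opM (a * a⁻¹ * b) = opM b := by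
  induction a using Quotient.inductionOn
  induction b using Quotient.inductionOn
  exact Quotient.sound (FInvRel.m_absorb _ _)

theorem inv_mul_inv_eq (a : FInv R) : a⁻¹ * a * a⁻¹ = a⁻¹ := by
  have := mul_inv_mul_eq a⁻¹
  rwa [inv_inv_eq] at this

theorem idem_eq {e : FInv R} (he : e * e = e) : e * e⁻¹ = e := by
  have hi : e⁻¹ * e⁻¹ = e⁻¹ := by rw [← mul_inv_rev_eq, he]
  have hc := idem_comm_eq e⁻¹ e
  rw [inv_inv_eq] at hc
  have h : e⁻¹ = e * e⁻¹ * e := by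
    calc e⁻¹ = e⁻¹ * e * (e * e⁻¹) := by
          rw [mul_assoc, ← mul_assoc e e, he, ← mul_assoc, inv_mul_inv_eq]
      _ = e * (e⁻¹ * e⁻¹) * e := by rw [hc]; simp only [mul_assoc]
      _ = e * e⁻¹ * e := by rw [hi]
  rw [mul_inv_mul_eq] at h
  rw [h, he]

instance instFInverseMonoid : FInverseMonoid (FInv R) where
  mul_inv_mul := mul_inv_mul_eq
  inv_mul_inv := inv_mul_inv_eq
  inv_unique a b h1 h2 := by
    have comm : ∀ {e f : FInv R}, e * e = e → f * f = f → e * f = f * e := by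
      intro e f he hf
      rw [← idem_eq he, ← idem_eq hf, idem_comm_eq]
    have i1 : a * b * (a * b) = a * b := by rw [← mul_assoc, h1]
    have i2 : a * a⁻¹ * (a * a⁻¹) = a * a⁻¹ := by rw [← mul_assoc, mul_inv_mul_eq]
    have i3 : b * a * (b * a) = b * a := by rw [← mul_assoc, h2]
    have i4 : a⁻¹ * a * (a⁻¹ * a) = a⁻¹ * a := by rw [← mul_assoc, inv_mul_inv_eq]
    have e1 : a * b = a * a⁻¹ := by
      calc a * b = a * a⁻¹ * (a * b) := by rw [← mul_assoc, mul_inv_mul_eq]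
        _ = a * b * (a * a⁻¹) := comm i2 i1
        _ = a * a⁻¹ := by rw [← mul_assoc, h1]
    have e2 : b * a = a⁻¹ * a := by
      calc b * a = b * a * (a⁻¹ * a) := by
            rw [mul_assoc, ← mul_assoc a, mul_inv_mul_eq]
        _ = a⁻¹ * a * (b * a) := comm i3 i4
        _ = a⁻¹ * a := by rw [mul_assoc, ← mul_assoc a, h1]
    calc b = b * a * b := h2.symm
      _ = a⁻¹ * (a * b) := by rw [e2, mul_assoc]
      _ = a⁻¹ := by rw [e1, ← mul_assoc, inv_mul_inv_eq]
  m := opM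
  sigma_m a := by
    refine ⟨a * a⁻¹, ?_, ?_⟩
    · rw [← mul_assoc, mul_inv_mul_eq]
    · rw [mul_inv_mul_m_eq, mul_inv_mul_eq]
  le_m a b h := by
    obtain ⟨e, he, hab⟩ := h
    have hm : opM a = opM b := by
      rw [← m_absorb_eq e a, ← m_absorb_eq e b, idem_eq he, hab]
    refine ⟨b * b⁻¹, ?_, ?_⟩
    · rw [← mul_assoc, mul_inv_mul_eq]
    · rw [hm, mul_inv_mul_m_eq]

theorem mk_ofWord (w : Word X) : mk R (.ofWord w) = wordVal (gen R) w := by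
  induction w with
  | nil => rfl
  | cons a w ih =>
    have h1 : wordVal (gen R) (a :: w) = letterVal (gen R) a * wordVal (gen R) w := by
      simp [wordVal]
    have h2 : mk R (.ofLetter a) = letterVal (gen R) a := by
      unfold FTerm.ofLetter letterVal
      split <;> rfl
    rw [h1, ← ih, ← h2]
    rfl

theorem mk_ofIm (w : ImTerm X) : mk R (.ofIm w) = w.valS (gen R) := by
  obtain ⟨u, t⟩ := w
  have ht : mk R (.ofTail t) =
      (t.map fun p => FInverseMonoid.m (wordVal (gen R) p.1) * wordVal (gen R) p.2).prod := by
    induction t with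
    | nil => rfl
    | cons p t ih =>
      rw [List.map_cons, List.prod_cons, ← ih, ← mk_ofWord, ← mk_ofWord]
      rfl
  rw [ImTerm.valS, ImTerm.val, ← ht, ← mk_ofWord]
  rfl

/-- `FInv⟨X | R⟩` is generated by `X`: every element is the value of a term. -/
theorem eval_gen (s : FTerm X) : FTerm.eval (gen R) s = mk R s := by
  induction s with
  | var => rfl
  | one => rfl
  | mul s t ih1 ih2 => rw [FTerm.eval, ih1, ih2]; rfl
  | inv s ih => rw [FTerm.eval, ih]; rfl
  | m s ih => rw [FTerm.eval, ih]; rfl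

/-- The relations hold in `FInv⟨X | R⟩`. -/
theorem valS_eq {u v : ImTerm X} (h : R u v) : u.valS (gen R) = v.valS (gen R) := by
  rw [← mk_ofIm, ← mk_ofIm]
  exact Quotient.sound (FInvRel.rel h)

/-- The relations hold in the greatest group image of `FInv⟨X | R⟩`. -/
theorem valG_eq (u v : ImTerm X) (h : R u v) :
    u.valG (groupGen (gen R)) = v.valG (groupGen (gen R)) := by
  rw [valG_groupGen, valG_groupGen, valS_eq h]

/-- The universal property of the presentation: terms that are equal in `FInv⟨X | R⟩` are equal in
every `F`-inverse monoid that satisfies the relations. -/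
theorem eval_eq {S : Type v} [FInverseMonoid S] (ι : X → S)
    (hι : ∀ u v, R u v → FTerm.eval ι (.ofIm u) = FTerm.eval ι (.ofIm v)) {s t : FTerm X}
    (h : mk R s = mk R t) : FTerm.eval ι s = FTerm.eval ι t := by
  have h' : FInvRel R s t := Quotient.exact h
  clear h
  induction h' with
  | refl => rfl
  | symm _ ih => exact ih.symm
  | trans _ _ ih1 ih2 => exact ih1.trans ih2
  | mul_congr _ _ ih1 ih2 => simp only [FTerm.eval, ih1, ih2]
  | inv_congr _ ih => simp only [FTerm.eval, ih]
  | m_congr _ ih => simp only [FTerm.eval, ih]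
  | mul_assoc => exact _root_.mul_assoc _ _ _
  | one_mul => exact _root_.one_mul _
  | mul_one => exact _root_.mul_one _
  | inv_inv => exact InverseMonoid.inv_inv' _
  | mul_inv_rev => exact InverseMonoid.mul_inv_rev' _ _
  | mul_inv_mul => exact InverseMonoid.mul_inv_mul _
  | idem_comm => exact InverseMonoid.idem_comm (mul_inv_idem _) (mul_inv_idem _)
  | mul_inv_mul_m => exact FInverseMonoid.mul_inv_mul_m _
  | m_absorb => exact FInverseMonoid.m_absorb _ _
  | rel h => exact hι _ _ h

end FInv

/-! ### The Cayley graph of a group and its subgraphs -/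

section Cayley

variable {X : Type u} {G : Type v} [Group G]

/-- Edges of the Cayley graph of `G` with respect to `ι : X → G`: for each `g` in `G` and each
letter `a` in `X ∪ X⁻¹` there is one edge from `g` to `g * a_G`. The vertex set is `G`. -/
@[ext] structure Edge (ι : X → G) : Type (max u v) where
  src : G
  label : Letter X

namespace Edge

variable {ι : X → G}

def tgt (e : Edge ι) : G := e.src * letterVal ι e.label

/-- The inverse edge. -/
def inv (e : Edge ι) : Edge ι := ⟨e.tgt, e.label.inv⟩

theorem letterVal_inv (a : Letter X) : letterVal ι a.inv = (letterVal ι a)⁻¹ := by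
  obtain ⟨x, b⟩ := a
  cases b <;> simp [letterVal, Letter.inv]

theorem tgt_inv (e : Edge ι) : e.inv.tgt = e.src := by
  simp [inv, tgt, letterVal_inv]

theorem inv_inv (e : Edge ι) : e.inv.inv = e := by
  ext1
  · exact tgt_inv e
  · simp [inv, Letter.inv]

end Edge

/-- Subgraphs of the Cayley graph: sets of vertices and edges closed under initial vertices,
terminal vertices and inverse edges (not necessarily connected). -/
@[ext] structure Sub (ι : X → G) : Type (max u v) where
  verts : Set G
  edges : Set (Edge ι)
  src_mem : ∀ e ∈ edges, e.src ∈ verts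
  tgt_mem : ∀ e ∈ edges, e.tgt ∈ verts
  inv_mem : ∀ e ∈ edges, e.inv ∈ edges

namespace Sub

variable {ι : X → G}

instance instPartialOrder : PartialOrder (Sub ι) :=
  PartialOrder.lift (fun D => (D.verts, D.edges)) fun D E h => by
    simp only [Prod.mk.injEq] at h
    exact Sub.ext h.1 h.2

theorem le_def {D E : Sub ι} : D ≤ E ↔ D.verts ⊆ E.verts ∧ D.edges ⊆ E.edges := Iff.rfl

/-- The complete lattice of subgraphs, with respect to union and intersection of the vertex sets and
of the edge sets. -/
instance instCompleteLattice : CompleteLattice (Sub ι) where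
  sup D E :=
    { verts := D.verts ∪ E.verts
      edges := D.edges ∪ E.edges
      src_mem := fun e he => he.imp (D.src_mem e) (E.src_mem e)
      tgt_mem := fun e he => he.imp (D.tgt_mem e) (E.tgt_mem e)
      inv_mem := fun e he => he.imp (D.inv_mem e) (E.inv_mem e) }
  le_sup_left _ _ := ⟨Set.subset_union_left, Set.subset_union_left⟩
  le_sup_right _ _ := ⟨Set.subset_union_right, Set.subset_union_right⟩
  sup_le _ _ _ h1 h2 := ⟨Set.union_subset h1.1 h2.1, Set.union_subset h1.2 h2.2⟩
  inf D E :=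
    { verts := D.verts ∩ E.verts
      edges := D.edges ∩ E.edges
      src_mem := fun e he => ⟨D.src_mem e he.1, E.src_mem e he.2⟩
      tgt_mem := fun e he => ⟨D.tgt_mem e he.1, E.tgt_mem e he.2⟩
      inv_mem := fun e he => ⟨D.inv_mem e he.1, E.inv_mem e he.2⟩ }
  inf_le_left _ _ := ⟨Set.inter_subset_left, Set.inter_subset_left⟩
  inf_le_right _ _ := ⟨Set.inter_subset_right, Set.inter_subset_right⟩
  le_inf _ _ _ h1 h2 := ⟨Set.subset_inter h1.1 h2.1, Set.subset_inter h1.2 h2.2⟩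
  sSup A :=
    { verts := {g | ∃ D ∈ A, g ∈ D.verts}
      edges := {e | ∃ D ∈ A, e ∈ D.edges}
      src_mem := fun e ⟨D, hD, he⟩ => ⟨D, hD, D.src_mem e he⟩
      tgt_mem := fun e ⟨D, hD, he⟩ => ⟨D, hD, D.tgt_mem e he⟩
      inv_mem := fun e ⟨D, hD, he⟩ => ⟨D, hD, D.inv_mem e he⟩ }
  isLUB_sSup _ :=
    ⟨fun D hD => ⟨fun _ h => ⟨D, hD, h⟩, fun _ h => ⟨D, hD, h⟩⟩,
     fun _ hE => ⟨fun _ ⟨_, hD, h⟩ => (hE hD).1 h, fun _ ⟨_, hD, h⟩ => (hE hD).2 h⟩⟩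
  sInf A :=
    { verts := {g | ∀ D ∈ A, g ∈ D.verts}
      edges := {e | ∀ D ∈ A, e ∈ D.edges}
      src_mem := fun e he D hD => D.src_mem e (he D hD)
      tgt_mem := fun e he D hD => D.tgt_mem e (he D hD)
      inv_mem := fun e he D hD => D.inv_mem e (he D hD) }
  isGLB_sInf _ :=
    ⟨fun D hD => ⟨fun _ h => h D hD, fun _ h => h D hD⟩,
     fun _ hE => ⟨fun _ h _ hD => (hE hD).1 h, fun _ h _ hD => (hE hD).2 h⟩⟩
  top := ⟨Set.univ, Set.univ, fun _ _ => trivial, fun _ _ => trivial, fun _ _ => trivial⟩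
  le_top _ := ⟨Set.subset_univ _, Set.subset_univ _⟩
  bot := ⟨∅, ∅, fun _ h => h.elim, fun _ h => h.elim, fun _ h => h.elim⟩
  bot_le _ := ⟨Set.empty_subset _, Set.empty_subset _⟩

end Sub

/-! ### Paths and journeys -/

/-- `Consecutive g l`: the edges in `l` form a path that starts at `g`. -/
def Consecutive {ι : X → G} : G → List (Edge ι) → Prop
  | _, [] => True
  | g, e :: l => e.src = g ∧ Consecutive e.tgt l

/-- The terminal vertex of the path with initial vertex `g` and edges `l`. -/
def pathEnd {ι : X → G} : G → List (Edge ι) → G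
  | g, [] => g
  | _, e :: l => pathEnd e.tgt l

/-- A path in the Cayley graph: an initial vertex and a (possibly empty) list of consecutive
edges. -/
structure Path (ι : X → G) : Type (max u v) where
  start : G
  edges : List (Edge ι)
  consecutive : Consecutive start edges

/-- The terminal vertex of a path. -/
def Path.finish {ι : X → G} (p : Path ι) : G := pathEnd p.start p.edges

/-- The subgraph spanned by a path. -/
def Path.span {ι : X → G} (p : Path ι) : Sub ι where
  verts := {g | g = p.start ∨ ∃ e ∈ p.edges, g = e.src ∨ g = e.tgt}
  edges := {e | e ∈ p.edges ∨ e.inv ∈ p.edges}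
  src_mem e he := by
    rcases he with he | he
    · exact Or.inr ⟨e, he, Or.inl rfl⟩
    · exact Or.inr ⟨e.inv, he, Or.inr e.tgt_inv.symm⟩
  tgt_mem e he := by
    rcases he with he | he
    · exact Or.inr ⟨e, he, Or.inr rfl⟩
    · exact Or.inr ⟨e.inv, he, Or.inl rfl⟩
  inv_mem e he := by
    rcases he with he | he
    · exact Or.inr (by rwa [Edge.inv_inv])
    · exact Or.inl he

/-- The edges of the path with initial vertex `g` and label `w`. -/
def edgesFrom (ι : X → G) : G → Word X → List (Edge ι)
  | _, [] => []
  | g, a :: w => ⟨g, a⟩ :: edgesFrom ι (g * letterVal ι a) w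

theorem consecutive_edgesFrom (ι : X → G) (g : G) (w : Word X) :
    Consecutive g (edgesFrom ι g w) := by
  induction w generalizing g with
  | nil => trivial
  | cons a w ih => exact ⟨rfl, ih _⟩

/-- The path with initial vertex `g` and label `w`. -/
def pathFrom (ι : X → G) (g : G) (w : Word X) : Path ι :=
  ⟨g, edgesFrom ι g w, consecutive_edgesFrom ι g w⟩

theorem pathFrom_finish (ι : X → G) (g : G) (w : Word X) :
    (pathFrom ι g w).finish = g * wordVal ι w := by
  change pathEnd g (edgesFrom ι g w) = _
  induction w generalizing g with
  | nil => simp [edgesFrom, pathEnd, wordVal]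
  | cons a w ih =>
    change pathEnd (g * letterVal ι a) (edgesFrom ι (g * letterVal ι a) w) = _
    rw [ih]
    simp [wordVal, mul_assoc]

/-- A journey: a non-empty sequence of paths, with jumps between them. A trivial jump (the next path
starts where the previous one ends) is allowed and means that the two paths are concatenated; this
changes neither the end points of a journey nor the subgraph that it spans. -/
structure Journey (ι : X → G) : Type (max u v) where
  first : Path ι
  rest : List (Path ι)

/-- The initial vertex of a journey. -/
def Journey.start {ι : X → G} (j : Journey ι) : G := j.first.start

/-- The terminal vertex of a journey, that is, of its last path. -/
def Journey.finish {ι : X → G} (j : Journey ι) : G :=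
  ((j.first :: j.rest).getLast (List.cons_ne_nil _ _)).finish

/-- The subgraph spanned by a journey. -/
def Journey.span {ι : X → G} (j : Journey ι) : Sub ι := ⨆ p ∈ j.first :: j.rest, p.span

/-- The paths labeled by `u₁, …, uₙ` in the journey labeled by `u₀ v₁ᵐ u₁ ⋯ vₙᵐ uₙ`, when the path
labeled by `u₀` ends at `h`. -/
def tailPaths (ι : X → G) : G → List (Word X × Word X) → List (Path ι)
  | _, [] => []
  | h, p :: t =>
    pathFrom ι (h * wordVal ι p.1) p.2 :: tailPaths ι (h * wordVal ι p.1 * wordVal ι p.2) t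

/-- The journey with initial vertex `g` and label `w`. -/
def journeyFrom (ι : X → G) (g : G) (w : ImTerm X) : Journey ι :=
  ⟨pathFrom ι g w.head, tailPaths ι (g * wordVal ι w.head) w.tail⟩

theorem journeyFrom_finish (ι : X → G) (g : G) (w : ImTerm X) :
    (journeyFrom ι g w).finish = g * w.valG ι := by
  have key : ∀ (t : List (Word X × Word X)) (g : G) (u : Word X),
      ((pathFrom ι g u :: tailPaths ι (g * wordVal ι u) t).getLast
        (List.cons_ne_nil _ _)).finish =
      g * (wordVal ι u * (t.map fun p => id (wordVal ι p.1) * wordVal ι p.2).prod) := by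
    intro t
    induction t with
    | nil => intro g u; simp [tailPaths, pathFrom_finish]
    | cons p t ih =>
      intro g u
      have h := ih (g * wordVal ι u * wordVal ι p.1) p.2
      simp only [tailPaths, List.getLast_cons (List.cons_ne_nil _ _)]
      rw [h]
      simp [mul_assoc]
  exact key w.tail g w.head

/-- The term `u` labels a journey from `g` to `h` in the subgraph `D`. (The Cayley graph is
deterministic, so there is exactly one journey in it with initial vertex `g` and label `u`.) -/
def LabelsJourney {ι : X → G} (D : Sub ι) (u : ImTerm X) (g h : G) : Prop :=
  (journeyFrom ι g u).finish = h ∧ (journeyFrom ι g u).span ≤ D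

/-! ### Closure operators and expansions -/

/-- The closed subgraphs for the relation `R` on terms. -/
def IsClosedFor {ι : X → G} (R : ImTerm X → ImTerm X → Prop) (D : Sub ι) : Prop :=
  ∀ u v, R u v → ∀ g ∈ D.verts, ∀ h ∈ D.verts, LabelsJourney D u g h ↔ LabelsJourney D v g h

theorem isClosedFor_sInf {ι : X → G} {R : ImTerm X → ImTerm X → Prop}
    (hR : ∀ u v, R u v → u.valG ι = v.valG ι) (A : Set (Sub ι))
    (hA : ∀ D ∈ A, IsClosedFor R D) : IsClosedFor R (sInf A) := by
  intro u v huv g hg h hh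
  have hfin : (journeyFrom ι g u).finish = (journeyFrom ι g v).finish := by
    rw [journeyFrom_finish, journeyFrom_finish, hR u v huv]
  have hD := fun D (hD : D ∈ A) => hA D hD u v huv g (hg D hD) h (hh D hD)
  constructor
  · rintro ⟨h1, h2⟩
    exact ⟨hfin ▸ h1, le_sInf fun D hDA => ((hD D hDA).1 ⟨h1, h2.trans (sInf_le hDA)⟩).2⟩
  · rintro ⟨h1, h2⟩
    exact ⟨hfin ▸ h1, le_sInf fun D hDA => ((hD D hDA).2 ⟨h1, h2.trans (sInf_le hDA)⟩).2⟩

/-- The closure operator `c_R` on the subgraphs of the Cayley graph of `G`, where `R` is a relation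
on terms such that related terms are equal in `G`. -/
def closureOp {ι : X → G} (R : ImTerm X → ImTerm X → Prop)
    (hR : ∀ u v, R u v → u.valG ι = v.valG ι) : ClosureOperator (Sub ι) :=
  ClosureOperator.ofCompletePred (IsClosedFor R) (isClosedFor_sInf hR)

/-- The full `P`-expansion of `D` with respect to `R`: for all `(u, v)` in `R` and each journey in
`D` labeled by `u` such that the coterminal journey labeled by `v` is not in `D`, the subgraph
spanned by the latter is added. -/
def fullExpansion {ι : X → G} (R : ImTerm X → ImTerm X → Prop) (D : Sub ι) : Sub ι :=
  D ⊔ sSup {E | ∃ u v g, R u v ∧ (journeyFrom ι g u).span ≤ D ∧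
    ¬ (journeyFrom ι g v).span ≤ D ∧ E = (journeyFrom ι g v).span}

/-- The iterated full `P`-expansions of `D` with respect to `R`. -/
def iterExpansion {ι : X → G} (R : ImTerm X → ImTerm X → Prop) (D : Sub ι) : ℕ → Sub ι
  | 0 => D
  | i + 1 => fullExpansion R (iterExpansion R D i)

end Cayley

/-! ### F-Schützenberger graphs -/

section Schutz

variable {X : Type u} {S : Type v} [FInverseMonoid S]

/-- Two terms have the same value in `S`. -/
def EqIn (ι : X → S) (u v : ImTerm X) : Prop := u.valS ι = v.valS ι

theorem EqIn.valG_eq (ι : X → S) (u v : ImTerm X) (h : EqIn ι u v) :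
    u.valG (groupGen ι) = v.valG (groupGen ι) := by
  rw [valG_groupGen, valG_groupGen, show u.valS ι = v.valS ι from h]

/-- The closure operator `c_S` on the subgraphs of the Cayley graph of the greatest group image. -/
def closureOpS (ι : X → S) : ClosureOperator (Sub (groupGen ι)) :=
  closureOp (EqIn ι) (EqIn.valG_eq ι)

/-- The `F`-Schützenberger graph of a term. -/
def FSchutz (ι : X → S) (w : ImTerm X) : Sub (groupGen ι) :=
  closureOpS ι (journeyFrom (groupGen ι) 1 w).span

end Schutz

/-- The closure operator `c_R` on the subgraphs of the Cayley graph of the greatest group image of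
`FInv⟨X | R⟩`. -/
def closureOpR {X : Type u} (R : ImTerm X → ImTerm X → Prop) :
    ClosureOperator (Sub (groupGen (FInv.gen R))) :=
  closureOp R FInv.valG_eq

end FInvPres

namespace FInvPres

/-! For a subgraph `Δ` of the Cayley graph, the partial right translations of its vertex set form an
`F`-inverse monoid, in which `X` acts along the edges of `Δ`. There, the value of a term `u` is the
translation by `u_G` whose domain consists of the vertices `g` for which the journey labeled by `u`
starting at `g` is in `Δ`. So `Δ` is `c_R`-closed if and only if this monoid satisfies the relations
`R`; by the universal property of `FInv⟨X | R⟩` it then identifies all terms with equal values in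
`FInv⟨X | R⟩`, that is, `Δ` is `c_S`-closed. The closure is reached after `ω` expansions because the
subgraph spanned by a journey is finite, hence a compact element of the lattice of subgraphs. -/

/-! ### The universal property for formal expressions -/

section Universal

variable {X : Type u} {S : Type v} [FInverseMonoid S]

theorem wordVal_nil {M : Type v} [Monoid M] [Inv M] (ι : X → M) : wordVal ι [] = 1 := rfl

theorem wordVal_cons {M : Type v} [Monoid M] [Inv M] (ι : X → M) (a : Letter X) (w : Word X) :
    wordVal ι (a :: w) = letterVal ι a * wordVal ι w :=
  List.prod_cons

theorem FTerm.eval_ofLetter (ι : X → S) (a : Letter X) :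
    (FTerm.ofLetter a).eval ι = letterVal ι a := by
  obtain ⟨x, _ | _⟩ := a <;> rfl

theorem FTerm.eval_ofWord (ι : X → S) (w : Word X) : (FTerm.ofWord w).eval ι = wordVal ι w := by
  induction w with
  | nil => rfl
  | cons a w ih => rw [ofWord, eval, eval_ofLetter, ih, wordVal_cons]

theorem FTerm.eval_ofTail (ι : X → S) (t : List (Word X × Word X)) :
    (FTerm.ofTail t).eval ι =
      (t.map fun p => FInverseMonoid.m (wordVal ι p.1) * wordVal ι p.2).prod := by
  induction t with
  | nil => rfl
  | cons p t ih => simp only [ofTail, eval, eval_ofWord, ih, List.map_cons, List.prod_cons]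

theorem FTerm.eval_ofIm (ι : X → S) (u : ImTerm X) : (FTerm.ofIm u).eval ι = u.valS ι := by
  rw [ofIm, eval, eval_ofWord, eval_ofTail, ImTerm.valS, ImTerm.val]

theorem EqIn.of_gen {R : ImTerm X → ImTerm X → Prop} {ι : X → S}
    (hι : ∀ u v, R u v → EqIn ι u v) {u v : ImTerm X} (h : EqIn (FInv.gen R) u v) :
    EqIn ι u v := by
  have hmk : FInv.mk R (.ofIm u) = FInv.mk R (.ofIm v) := by
    rw [FInv.mk_ofIm, FInv.mk_ofIm]
    exact h
  have heval := FInv.eval_eq ι (fun u v huv => ?_) hmk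
  · rwa [FTerm.eval_ofIm, FTerm.eval_ofIm] at heval
  · rw [FTerm.eval_ofIm, FTerm.eval_ofIm]
    exact hι u v huv

end Universal

/-! ### Partial right translations -/

/-- A partial right translation of a set `V` of elements of a group: the partial map of `V` with the
given domain that sends `g` to `g * shift`. The shift is part of the data even when the domain is
empty: this makes `shift` a homomorphism that separates the `σ`-classes. -/
@[ext] structure PartialTranslation {G : Type v} [Group G] (V : Set G) where
  domain : Set G
  shift : G
  domain_subset : domain ⊆ V
  mul_shift_mem : ∀ g ∈ domain, g * shift ∈ V

namespace PartialTranslation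

variable {G : Type v} [Group G] {V : Set G}

instance instMonoid : Monoid (PartialTranslation V) where
  mul a b :=
    { domain := {g | g ∈ a.domain ∧ g * a.shift ∈ b.domain}
      shift := a.shift * b.shift
      domain_subset := fun _ hg => a.domain_subset hg.1
      mul_shift_mem := fun g hg => by
        rw [← mul_assoc]
        exact b.mul_shift_mem _ hg.2 }
  one := ⟨V, 1, subset_rfl, fun g hg => by rwa [mul_one]⟩
  mul_assoc a b c := by
    ext g
    · change (_ ∧ _) ∧ g * (a.shift * b.shift) ∈ _ ↔ _ ∧ _ ∧ g * a.shift * b.shift ∈ _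
      rw [mul_assoc, and_assoc]
    · exact mul_assoc _ _ _
  one_mul a := by
    ext g
    · change g ∈ V ∧ g * 1 ∈ a.domain ↔ _
      rw [mul_one]
      exact and_iff_right_of_imp (@a.domain_subset g)
    · exact one_mul _
  mul_one a := by
    ext g
    · exact and_iff_left_of_imp (a.mul_shift_mem g)
    · exact mul_one _

instance instInv : Inv (PartialTranslation V) where
  inv a :=
    { domain := {g | g * a.shift⁻¹ ∈ a.domain}
      shift := a.shift⁻¹
      domain_subset := fun g hg => by simpa using a.mul_shift_mem _ hg
      mul_shift_mem := fun _ hg => a.domain_subset hg }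

theorem mem_domain_one {g : G} : g ∈ (1 : PartialTranslation V).domain ↔ g ∈ V := Iff.rfl

theorem mem_domain_mul {a b : PartialTranslation V} {g : G} :
    g ∈ (a * b).domain ↔ g ∈ a.domain ∧ g * a.shift ∈ b.domain := Iff.rfl

theorem shift_mul (a b : PartialTranslation V) : (a * b).shift = a.shift * b.shift := rfl

theorem mem_domain_inv {a : PartialTranslation V} {g : G} :
    g ∈ a⁻¹.domain ↔ g * a.shift⁻¹ ∈ a.domain := Iff.rfl

theorem shift_inv (a : PartialTranslation V) : a⁻¹.shift = a.shift⁻¹ := rfl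

theorem mem_domain_mul_inv {a : PartialTranslation V} {g : G} :
    g ∈ (a * a⁻¹).domain ↔ g ∈ a.domain := by
  rw [mem_domain_mul, mem_domain_inv, mul_inv_cancel_right, and_self]

theorem shift_mul_inv (a : PartialTranslation V) : (a * a⁻¹).shift = 1 := mul_inv_cancel a.shift

theorem eq_inv_of_mul_mul_eq {a b : PartialTranslation V} (hab : a * b * a = a)
    (hba : b * a * b = b) : b = a⁻¹ := by
  have hshift : b.shift = a.shift⁻¹ := by
    have h := congrArg shift hab
    rw [shift_mul, shift_mul, mul_eq_right] at h
    exact (inv_eq_of_mul_eq_one_right h).symm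
  have ha : ∀ g ∈ a.domain, g * a.shift ∈ b.domain := fun g hg => by
    rw [← hab] at hg
    exact hg.1.2
  have hb : ∀ g ∈ b.domain, g * b.shift ∈ a.domain := fun g hg => by
    rw [← hba] at hg
    exact hg.1.2
  ext g
  · rw [mem_domain_inv, ← hshift]
    refine ⟨hb g, fun hg => ?_⟩
    simpa [hshift] using ha _ hg
  · exact hshift

instance instInverseMonoid : InverseMonoid (PartialTranslation V) where
  mul_inv_mul a := by
    ext g
    · rw [mem_domain_mul, mem_domain_mul_inv, shift_mul_inv, mul_one, and_self]
    · rw [shift_mul, shift_mul_inv, one_mul]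
  inv_mul_inv a := by
    ext g
    · simp [mem_domain_mul, mem_domain_inv, shift_mul, shift_inv]
    · simp [shift_mul, shift_inv]
  inv_unique _ _ := eq_inv_of_mul_mul_eq

theorem sigma_iff {a b : PartialTranslation V} : InverseMonoid.Sigma a b ↔ a.shift = b.shift := by
  constructor
  · rintro ⟨e, -, h⟩
    exact mul_left_cancel (congrArg shift h)
  · intro h
    refine ⟨a * a⁻¹ * (b * b⁻¹), InverseMonoid.idem_mul_idem (InverseMonoid.mul_inv_idem a)
      (InverseMonoid.mul_inv_idem b), ?_⟩
    ext g
    · simp only [mem_domain_mul (a := _ * _), mem_domain_mul_inv, shift_mul _ (_ * _),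
        shift_mul_inv, mul_one]
      tauto
    · rw [shift_mul, shift_mul _ b, h]

/-- The greatest partial translation with a given shift is defined wherever the result is in `V`. -/
instance instFInverseMonoid : FInverseMonoid (PartialTranslation V) where
  m a := ⟨{g | g ∈ V ∧ g * a.shift ∈ V}, a.shift, fun _ hg => hg.1, fun _ hg => hg.2⟩
  sigma_m _ := sigma_iff.2 rfl
  le_m a b h := by
    have hshift := sigma_iff.1 h
    refine ⟨b * b⁻¹, InverseMonoid.mul_inv_idem b, ?_⟩
    ext g
    · rw [mem_domain_mul, mem_domain_mul_inv, shift_mul_inv, mul_one, hshift]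
      exact (and_iff_left_of_imp fun hg => ⟨b.domain_subset hg, b.mul_shift_mem g hg⟩).symm
    · rw [shift_mul, shift_mul_inv, one_mul, hshift]

theorem mem_domain_m {a : PartialTranslation V} {g : G} :
    g ∈ (FInverseMonoid.m a).domain ↔ g ∈ V ∧ g * a.shift ∈ V := Iff.rfl

theorem shift_m (a : PartialTranslation V) : (FInverseMonoid.m a).shift = a.shift := rfl

end PartialTranslation

section Cayley

variable {X : Type u} {G : Type v} [Group G] {ι : X → G} {D : Sub ι}

/-! ### Journeys as values of terms -/

theorem Path.span_le_iff {p : Path ι} :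
    p.span ≤ D ↔ p.start ∈ D.verts ∧ ∀ e ∈ p.edges, e ∈ D.edges := by
  constructor
  · exact fun h => ⟨h.1 (Or.inl rfl), fun e he => h.2 (Or.inl he)⟩
  · rintro ⟨hstart, hedges⟩
    constructor
    · rintro g (rfl | ⟨e, he, rfl | rfl⟩)
      · exact hstart
      · exact D.src_mem e (hedges e he)
      · exact D.tgt_mem e (hedges e he)
    · rintro e (he | he)
      · exact hedges e he
      · rw [← e.inv_inv]
        exact D.inv_mem _ (hedges _ he)

theorem Journey.span_le_iff {j : Journey ι} :
    j.span ≤ D ↔ ∀ p ∈ j.first :: j.rest, p.span ≤ D :=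
  iSup₂_le_iff

theorem pathFrom_nil_span_le_iff {g : G} : (pathFrom ι g []).span ≤ D ↔ g ∈ D.verts := by
  simp [Path.span_le_iff, pathFrom, edgesFrom]

theorem pathFrom_cons_span_le_iff {g : G} {a : Letter X} {w : Word X} :
    (pathFrom ι g (a :: w)).span ≤ D ↔
      (⟨g, a⟩ : Edge ι) ∈ D.edges ∧ (pathFrom ι (g * letterVal ι a) w).span ≤ D := by
  simp only [Path.span_le_iff, pathFrom, edgesFrom, List.mem_cons, forall_eq_or_imp]
  exact ⟨fun ⟨_, ha, hw⟩ => ⟨ha, D.tgt_mem _ ha, hw⟩, fun ⟨ha, _, hw⟩ => ⟨D.src_mem _ ha, ha, hw⟩⟩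

/-- The partial translation of the vertices of `D` along its edges labeled by a generator. -/
def Sub.translation (D : Sub ι) (x : X) : PartialTranslation D.verts where
  domain := {g | (⟨g, (x, true)⟩ : Edge ι) ∈ D.edges}
  shift := ι x
  domain_subset _ hg := D.src_mem _ hg
  mul_shift_mem _ hg := D.tgt_mem _ hg

open PartialTranslation

theorem shift_letterVal_translation (D : Sub ι) (a : Letter X) :
    (letterVal D.translation a).shift = letterVal ι a := by
  obtain ⟨x, _ | _⟩ := a <;> rfl

theorem mem_domain_letterVal_translation {a : Letter X} {g : G} :
    g ∈ (letterVal D.translation a).domain ↔ (⟨g, a⟩ : Edge ι) ∈ D.edges := by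
  obtain ⟨x, _ | _⟩ := a
  · change (⟨g, (x, false)⟩ : Edge ι).inv ∈ D.edges ↔ _
    refine ⟨fun h => ?_, D.inv_mem _⟩
    simpa only [Edge.inv_inv] using D.inv_mem _ h
  · rfl

theorem shift_wordVal_translation (D : Sub ι) (w : Word X) :
    (wordVal D.translation w).shift = wordVal ι w := by
  induction w with
  | nil => rfl
  | cons a w ih => rw [wordVal_cons, shift_mul, shift_letterVal_translation, ih, wordVal_cons]

theorem mem_domain_wordVal_translation {w : Word X} {g : G} :
    g ∈ (wordVal D.translation w).domain ↔ (pathFrom ι g w).span ≤ D := by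
  induction w generalizing g with
  | nil => rw [wordVal_nil, mem_domain_one, pathFrom_nil_span_le_iff]
  | cons a w ih =>
    rw [wordVal_cons, mem_domain_mul, mem_domain_letterVal_translation,
      shift_letterVal_translation, ih, pathFrom_cons_span_le_iff]

theorem shift_valS_translation (D : Sub ι) (u : ImTerm X) :
    (u.valS D.translation).shift = u.valG ι := by
  obtain ⟨w, t⟩ := u
  rw [ImTerm.valS, ImTerm.valG, ImTerm.val, ImTerm.val, shift_mul, shift_wordVal_translation]
  congr 1
  induction t with
  | nil => rfl
  | cons p t ih =>
    simp only [List.map_cons, List.prod_cons, shift_mul, shift_m, shift_wordVal_translation, ih,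
      id_eq]

theorem mem_domain_tail_translation {t : List (Word X × Word X)} {g : G} :
    g ∈ (t.map fun p => FInverseMonoid.m (wordVal D.translation p.1) *
        wordVal D.translation p.2).prod.domain ↔
      g ∈ D.verts ∧ ∀ p ∈ tailPaths ι g t, p.span ≤ D := by
  induction t generalizing g with
  | nil => simp [mem_domain_one, tailPaths]
  | cons p t ih =>
    simp only [List.map_cons, List.prod_cons, mem_domain_mul, mem_domain_m, shift_mul, shift_m,
      ih, tailPaths, List.forall_mem_cons, ← mem_domain_wordVal_translation,
      shift_wordVal_translation, ← mul_assoc]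
    refine ⟨fun ⟨⟨⟨hg, _⟩, hp⟩, _, ht⟩ => ⟨hg, hp, ht⟩, fun ⟨hg, hp, ht⟩ =>
      ⟨⟨⟨hg, domain_subset _ hp⟩, hp⟩, ?_, ht⟩⟩
    simpa only [shift_wordVal_translation] using mul_shift_mem _ _ hp

theorem mem_domain_valS_translation {u : ImTerm X} {g : G} :
    g ∈ (u.valS D.translation).domain ↔ (journeyFrom ι g u).span ≤ D := by
  rw [ImTerm.valS, ImTerm.val, mem_domain_mul, mem_domain_tail_translation, Journey.span_le_iff,
    journeyFrom, List.forall_mem_cons, shift_wordVal_translation,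
    ← mem_domain_wordVal_translation]
  refine and_congr_right fun hg => and_iff_right ?_
  simpa only [shift_wordVal_translation] using mul_shift_mem _ _ hg

theorem journeyFrom_start_mem {g : G} {u : ImTerm X} (h : (journeyFrom ι g u).span ≤ D) :
    g ∈ D.verts :=
  domain_subset _ (mem_domain_valS_translation.2 h)

theorem journeyFrom_finish_mem {g : G} {u : ImTerm X} (h : (journeyFrom ι g u).span ≤ D) :
    g * u.valG ι ∈ D.verts := by
  rw [← shift_valS_translation D]
  exact mul_shift_mem _ g (mem_domain_valS_translation.2 h)

theorem eqIn_translation_iff {u v : ImTerm X} :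
    EqIn D.translation u v ↔ u.valG ι = v.valG ι ∧
      ∀ g, (journeyFrom ι g u).span ≤ D ↔ (journeyFrom ι g v).span ≤ D := by
  simp only [EqIn, PartialTranslation.ext_iff, Set.ext_iff, mem_domain_valS_translation,
    shift_valS_translation, and_comm]

/-! ### Closed subgraphs -/

variable {R : ImTerm X → ImTerm X → Prop}

theorem isClosedFor_iff (hR : ∀ u v, R u v → u.valG ι = v.valG ι) :
    IsClosedFor R D ↔
      ∀ u v, R u v → ∀ g, (journeyFrom ι g u).span ≤ D ↔ (journeyFrom ι g v).span ≤ D := by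
  constructor
  · intro hD u v huv g
    constructor
    · intro hu
      exact ((hD u v huv g (journeyFrom_start_mem hu) _ (journeyFrom_finish_mem hu)).1
        ⟨journeyFrom_finish _ _ _, hu⟩).2
    · intro hv
      exact ((hD u v huv g (journeyFrom_start_mem hv) _ (journeyFrom_finish_mem hv)).2
        ⟨journeyFrom_finish _ _ _, hv⟩).2
  · intro h u v huv g _ k _
    simp only [LabelsJourney, journeyFrom_finish, hR u v huv, h u v huv g]

theorem isClosedFor_iff_eqIn_translation (hR : ∀ u v, R u v → u.valG ι = v.valG ι) :
    IsClosedFor R D ↔ ∀ u v, R u v → EqIn D.translation u v := by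
  simp only [isClosedFor_iff hR, eqIn_translation_iff]
  exact forall₃_congr fun u v huv => (and_iff_right (hR u v huv)).symm

theorem isClosedFor_eqIn_gen_iff (hR : ∀ u v, R u v → u.valG ι = v.valG ι) :
    IsClosedFor (EqIn (FInv.gen R)) D ↔ IsClosedFor R D := by
  constructor
  · exact fun hD u v huv => hD u v (FInv.valS_eq huv)
  · intro hD
    have hgen : ∀ u v, EqIn (FInv.gen R) u v → EqIn D.translation u v := fun _ _ =>
      EqIn.of_gen ((isClosedFor_iff_eqIn_translation hR).1 hD)
    exact (isClosedFor_iff_eqIn_translation fun u v huv =>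
      (eqIn_translation_iff.1 (hgen u v huv)).1).2 hgen

/-! ### Expansions -/

theorem fullExpansion_le_iff {E : Sub ι} :
    fullExpansion R D ≤ E ↔ D ≤ E ∧
      ∀ u v, R u v → ∀ g, (journeyFrom ι g u).span ≤ D → (journeyFrom ι g v).span ≤ E := by
  rw [fullExpansion, sup_le_iff, sSup_le_iff]
  refine and_congr_right fun hDE => ⟨fun h u v huv g hu => ?_, ?_⟩
  · by_cases hv : (journeyFrom ι g v).span ≤ D
    · exact hv.trans hDE
    · exact h _ ⟨u, v, g, huv, hu, hv, rfl⟩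
  · rintro h _ ⟨u, v, g, huv, hu, -, rfl⟩
    exact h u v huv g hu

theorem le_fullExpansion (R : ImTerm X → ImTerm X → Prop) (D : Sub ι) : D ≤ fullExpansion R D :=
  (fullExpansion_le_iff.1 le_rfl).1

theorem span_le_fullExpansion {u v : ImTerm X} (huv : R u v) {g : G}
    (hu : (journeyFrom ι g u).span ≤ D) : (journeyFrom ι g v).span ≤ fullExpansion R D :=
  (fullExpansion_le_iff.1 le_rfl).2 u v huv g hu

theorem fullExpansion_mono : Monotone (fullExpansion R : Sub ι → Sub ι) := fun _ E hDE =>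
  fullExpansion_le_iff.2 ⟨hDE.trans (le_fullExpansion R E), fun _ _ huv _ hu =>
    span_le_fullExpansion huv (hu.trans hDE)⟩

theorem IsClosedFor.fullExpansion_le (hR : ∀ u v, R u v → u.valG ι = v.valG ι)
    (hD : IsClosedFor R D) : fullExpansion R D ≤ D :=
  fullExpansion_le_iff.2 ⟨le_rfl, fun u v huv g => ((isClosedFor_iff hR).1 hD u v huv g).1⟩

theorem isClosedFor_of_fullExpansion_le (hR : ∀ u v, R u v → u.valG ι = v.valG ι)
    (hsymm : ∀ u v, R u v → R v u) (hD : fullExpansion R D ≤ D) : IsClosedFor R D :=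
  have h := (fullExpansion_le_iff.1 hD).2
  (isClosedFor_iff hR).2 fun u v huv g => ⟨h u v huv g, h v u (hsymm u v huv) g⟩

theorem monotone_iterExpansion (R : ImTerm X → ImTerm X → Prop) (D : Sub ι) :
    Monotone (iterExpansion R D) :=
  monotone_nat_of_le_succ fun _ => le_fullExpansion R _

theorem iterExpansion_le {E : Sub ι} (hE : fullExpansion R E ≤ E) (hDE : D ≤ E) (i : ℕ) :
    iterExpansion R D i ≤ E := by
  induction i with
  | zero => exact hDE
  | succ i ih => exact (fullExpansion_mono ih).trans hE

theorem Path.isCompactElement_span (p : Path ι) : IsCompactElement p.span := by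
  classical
  rw [CompleteLattice.isCompactElement_iff_le_of_directed_sSup_le]
  intro A hne hdir hp
  obtain ⟨⟨D, hD, hstart⟩, hedges⟩ := Path.span_le_iff.1 hp
  obtain ⟨E, hE, hpE⟩ := DirectedOn.exists_mem_subset_of_finset_subset_biUnion
    (f := Sub.edges) (s := p.edges.toFinset) hne (hdir.mono fun _ _ h => h.2) fun e he => by
      obtain ⟨E, hE, he⟩ := hedges e (List.mem_toFinset.1 he)
      exact Set.mem_biUnion hE he
  obtain ⟨F, hF, hDF, hEF⟩ := hdir D hD E hE
  exact ⟨F, hF, Path.span_le_iff.2 ⟨hDF.1 hstart, fun e he => hEF.2 (hpE (List.mem_toFinset.2 he))⟩⟩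

theorem Journey.isCompactElement_span (j : Journey ι) : IsCompactElement j.span := by
  classical
  have hspan : j.span = (j.first :: j.rest).toFinset.sup Path.span := by
    simp only [Journey.span, Finset.sup_eq_iSup, List.mem_toFinset]
  rw [hspan]
  exact CompleteLattice.isCompactElement_finsetSup _ fun p _ => p.isCompactElement_span

theorem fullExpansion_iSup_iterExpansion_le (R : ImTerm X → ImTerm X → Prop) (D : Sub ι) :
    fullExpansion R (⨆ i, iterExpansion R D i) ≤ ⨆ i, iterExpansion R D i := by
  refine fullExpansion_le_iff.2 ⟨le_rfl, fun u v huv g hu => ?_⟩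
  obtain ⟨_, ⟨i, rfl⟩, hi⟩ :=
    (CompleteLattice.isCompactElement_iff_le_of_directed_sSup_le _ _).1
      (journeyFrom ι g u).isCompactElement_span _ (Set.range_nonempty (iterExpansion R D))
      (directedOn_range.2 (monotone_iterExpansion R D).directed_le) hu
  exact (span_le_fullExpansion huv hi).trans (le_iSup (iterExpansion R D) (i + 1))

theorem closureOp_eq_iSup_iterExpansion (hR : ∀ u v, R u v → u.valG ι = v.valG ι)
    (hsymm : ∀ u v, R u v → R v u) (D : Sub ι) :
    closureOp R hR D = ⨆ i, iterExpansion R D i := by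
  refine le_antisymm ?_ (iSup_le fun i => ?_)
  · have hclosed : (closureOp R hR).IsClosed (⨆ i, iterExpansion R D i) :=
      isClosedFor_of_fullExpansion_le hR hsymm (fullExpansion_iSup_iterExpansion_le R D)
    exact ClosureOperator.closure_min (le_iSup (iterExpansion R D) 0) hclosed
  · have hclosed : IsClosedFor R (closureOp R hR D) := (closureOp R hR).isClosed_closure D
    exact iterExpansion_le (hclosed.fullExpansion_le hR) ((closureOp R hR).le_closure D) i

theorem iSup_one_le_iterExpansion (R : ImTerm X → ImTerm X → Prop) (D : Sub ι) :
    ⨆ (i : ℕ) (_ : 1 ≤ i), iterExpansion R D i = ⨆ i, iterExpansion R D i :=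
  (iSup_ge_eq_iSup_nat_add _ 1).trans ((monotone_iterExpansion R D).iSup_nat_add 1)

end Cayley

theorem closureOpS_gen {X : Type u} (R : ImTerm X → ImTerm X → Prop) :
    closureOpS (FInv.gen R) = closureOpR R :=
  ClosureOperator.ext_isClosed _ _ fun _ => isClosedFor_eqIn_gen_iff FInv.valG_eq

end FInvPres

theorem mainTheorem4 {X : Type*} (R : FInvPres.ImTerm X → FInvPres.ImTerm X → Prop)
    (hR : ∀ u v, R u v → R v u) (w : FInvPres.ImTerm X) :
    FInvPres.FSchutz (FInvPres.FInv.gen R) w =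
      FInvPres.closureOpR R
        (FInvPres.journeyFrom (FInvPres.groupGen (FInvPres.FInv.gen R)) 1 w).span ∧
    IsLeast {D : FInvPres.Sub (FInvPres.groupGen (FInvPres.FInv.gen R)) |
        (FInvPres.closureOpR R).IsClosed D ∧
          (FInvPres.journeyFrom (FInvPres.groupGen (FInvPres.FInv.gen R)) 1 w).span ≤ D}
      (FInvPres.FSchutz (FInvPres.FInv.gen R) w) ∧
    FInvPres.FSchutz (FInvPres.FInv.gen R) w =
      ⨆ (i : ℕ) (_ : 1 ≤ i), FInvPres.iterExpansion R
        (FInvPres.journeyFrom (FInvPres.groupGen (FInvPres.FInv.gen R)) 1 w).span i := by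
  rw [FInvPres.FSchutz, FInvPres.closureOpS_gen, FInvPres.iSup_one_le_iterExpansion]
  refine ⟨rfl, ⟨⟨ClosureOperator.isClosed_closure _ _, ClosureOperator.le_closure _ _⟩, ?_⟩, ?_⟩
  · rintro D ⟨hD, hwD⟩
    exact ClosureOperator.closure_min hwD hD
  · exact FInvPres.closureOp_eq_iSup_iterExpansion FInvPres.FInv.valG_eq hR _
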